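/- All graphs are finite, simple and undirected. A perfect Italian dominating function of a graph $G=(V,E)$ is a function $f\colon V\to\{0,1,2\}$ such that $\sum_{u\in N(v)} f(u)=2$ for every vertex $v$ with $f(v)=0$. Its weight is $\sum_{v\in V} f(v)$, and $\mathrm{pid}(G)$ denotes the minimum weight of a perfect Italian dominating function of $G$. **Theorem.** Every connected cubic graph $G$ on $n$ vertices satisfies $$\tfrac{2}{5}\,n \;\le\; \mathrm{pid}(G) \;\le\; \tfrac{2}{3}\,n .$$ Moreover, both bounds are tight: 1. there is a connected cubic graph on $n$ vertices, for some $n$, with $\mathrm{pid}(G)=\tfrac25 n$; also, the cube $Q_3=P_2\Box P_2\Box P_2$, a connected cubic graph on $8$ vertices, has $\mathrm{pid}(Q_3)=4=\lceil \tfrac25\cdot 8\rceil$; 2. the connected cubic graphs $K_3\Box K_2$ and $K_{3,3}$ on $6$ vertices have $\mathrm{pid}(K_3\Box K_2)=\mathrm{pid}(K_{3,3})=4=\tfrac23\cdot 6$. -/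

import Mathlib

namespace PerfectItalian

open Classical in
/-- A labeling `f : V → {0, 1, 2}` is a perfect Italian dominating function of `G` if, at every
vertex with label `0`, the labels of the neighbors sum to exactly `2`. -/
def IsPID {V : Type*} [Fintype V] (G : SimpleGraph V) (f : V → Fin 3) : Prop :=
  ∀ v, f v = 0 → ∑ u ∈ G.neighborFinset v, (f u : ℕ) = 2

/-- The weight of a labeling is the sum of all its labels. -/
def weight {V : Type*} [Fintype V] (f : V → Fin 3) : ℕ :=
  ∑ v, (f v : ℕ)

/-- The perfect Italian domination number: the minimum weight of a perfect Italian dominating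
function. The minimum is attained, see `isLeast_pid`. -/
noncomputable def pid {V : Type*} [Fintype V] (G : SimpleGraph V) : ℕ :=
  sInf {w | ∃ f : V → Fin 3, IsPID G f ∧ weight f = w}

theorem isLeast_pid {V : Type*} [Fintype V] (G : SimpleGraph V) :
    IsLeast {w | ∃ f : V → Fin 3, IsPID G f ∧ weight f = w} (pid G) := by
  have hne : {w | ∃ f : V → Fin 3, IsPID G f ∧ weight f = w}.Nonempty :=
    ⟨_, fun _ => 1, fun _ h => absurd h one_ne_zero, rfl⟩
  exact ⟨Nat.sInf_mem hne, fun _ h => Nat.sInf_le h⟩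

open Classical in
/-- A (finite) cubic graph: every vertex has degree `3`. -/
def IsCubic {V : Type*} [Fintype V] (G : SimpleGraph V) : Prop :=
  G.IsRegularOfDegree 3

/-- The 3-dimensional cube `Q₃ = P₂ □ P₂ □ P₂`. -/
def Q3 : SimpleGraph ((Fin 2 × Fin 2) × Fin 2) :=
  ((SimpleGraph.pathGraph 2).boxProd (SimpleGraph.pathGraph 2)).boxProd (SimpleGraph.pathGraph 2)

/-- The triangular prism `K₃ □ K₂`. -/
def K3boxK2 : SimpleGraph (Fin 3 × Fin 2) :=
  (⊤ : SimpleGraph (Fin 3)).boxProd (⊤ : SimpleGraph (Fin 2))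

/-- The complete bipartite graph `K₃,₃`. -/
def K33 : SimpleGraph (Fin 3 ⊕ Fin 3) :=
  completeBipartiteGraph (Fin 3) (Fin 3)

end PerfectItalian

namespace PerfectItalian

section

variable {V : Type*} {G : SimpleGraph V} {A : Finset V}

/-- `u` is the only neighbor of `x` in `A`. -/
def OnlyNbr (G : SimpleGraph V) (A : Finset V) (x u : V) : Prop :=
  ∀ w, (w ∈ A ∧ G.Adj x w) ↔ w = u

/-- `A` is the vertex set of an induced matching of `G`. -/
def IsInducedMatching (G : SimpleGraph V) (A : Finset V) : Prop :=
  ∀ a ∈ A, ∃ v, OnlyNbr G A a v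

open Classical in
/-- The vertices without neighbor in `A`. -/
noncomputable def undominated [Fintype V] (G : SimpleGraph V) (A : Finset V) : Finset V :=
  Finset.univ.filter fun x => ∀ a ∈ A, ¬ G.Adj x a

/-- `A` is the vertex set of a maximum induced matching which, among those, leaves the fewest
vertices undominated. -/
structure IsOptimal [Fintype V] (G : SimpleGraph V) (A : Finset V) : Prop where
  isInducedMatching : IsInducedMatching G A
  card_le : ∀ B, IsInducedMatching G B → B.card ≤ A.card
  undominated_le : ∀ B, IsInducedMatching G B → B.card = A.card →
    (undominated G A).card ≤ (undominated G B).card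

theorem mem_undominated [Fintype V] {x : V} :
    x ∈ undominated G A ↔ ∀ a ∈ A, ¬ G.Adj x a := by
  simp [undominated]

theorem exists_isOptimal [Fintype V] (G : SimpleGraph V) : ∃ A, IsOptimal G A := by
  classical
  obtain ⟨A, hA, hmax⟩ := Finset.exists_max_image
    ((Finset.univ : Finset (Finset V)).filter (IsInducedMatching G))
    (fun A => toLex (A.card, OrderDual.toDual (undominated G A).card))
    ⟨∅, by simp [IsInducedMatching]⟩
  simp only [Finset.mem_filter, Finset.mem_univ, true_and, Prod.Lex.toLex_le_toLex] at hA hmax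
  refine ⟨A, hA, fun B hB => ?_, fun B hB h => ?_⟩
  · rcases hmax B hB with h | h
    · exact h.le
    · exact h.1.le
  · rcases hmax B hB with h' | h'
    · exact absurd h h'.ne
    · exact h'.2

theorem OnlyNbr.mem {x u : V} (h : OnlyNbr G A x u) : u ∈ A := ((h u).2 rfl).1

theorem OnlyNbr.adj {x u : V} (h : OnlyNbr G A x u) : G.Adj x u := ((h u).2 rfl).2

theorem OnlyNbr.eq {x u w : V} (h : OnlyNbr G A x u) (hw : w ∈ A) (hx : G.Adj x w) : w = u :=
  (h w).1 ⟨hw, hx⟩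

theorem IsInducedMatching.symm (hA : IsInducedMatching G A) {u v : V} (hu : u ∈ A)
    (h : OnlyNbr G A u v) : OnlyNbr G A v u := by
  obtain ⟨w, hw⟩ := hA v h.mem
  rwa [hw.eq hu h.adj.symm]

theorem IsInducedMatching.onlyNbr (hA : IsInducedMatching G A) {u v : V} (hu : u ∈ A)
    (hv : v ∈ A) (h : G.Adj u v) : OnlyNbr G A u v := by
  obtain ⟨w, hw⟩ := hA u hu
  rwa [hw.eq hv h]

theorem IsOptimal.not_adj_of_undominated [Fintype V] (hA : IsOptimal G A) {x y : V}
    (hx : ∀ a ∈ A, ¬ G.Adj x a) (hy : ∀ a ∈ A, ¬ G.Adj y a) : ¬ G.Adj x y := by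
  classical
  intro hxy
  have hxA : x ∉ A := fun h => hy x h hxy.symm
  have hyA : y ∉ A := fun h => hx y h hxy
  have hne := hxy.ne
  have : IsInducedMatching G (insert x (insert y A)) := by
    intro a ha
    simp only [Finset.mem_insert] at ha
    rcases ha with rfl | rfl | ha
    · refine ⟨y, fun w => ?_⟩
      simp only [Finset.mem_insert]
      grind [G.loopless, SimpleGraph.irrefl]
    · refine ⟨x, fun w => ?_⟩
      simp only [Finset.mem_insert]
      grind [SimpleGraph.irrefl, SimpleGraph.adj_comm]
    · obtain ⟨v, hv⟩ := hA.isInducedMatching a ha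
      refine ⟨v, fun w => ?_⟩
      have := hv w
      have h1 := hx a ha
      have h2 := hy a ha
      simp only [Finset.mem_insert]
      grind [SimpleGraph.adj_comm]
  have := hA.card_le _ this
  rw [Finset.card_insert_of_notMem (by simp [hne, hxA]), Finset.card_insert_of_notMem hyA] at this
  omega

/-- The vertex set obtained from `A` by replacing `v` with `b`. -/
def swap [DecidableEq V] (A : Finset V) (v b : V) : Finset V := insert b (A.erase v)

theorem mem_swap [DecidableEq V] {v b w : V} : w ∈ swap A v b ↔ w = b ∨ (w ≠ v ∧ w ∈ A) := by
  simp [swap]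

theorem card_swap [DecidableEq V] {v b : V} (hv : v ∈ A) (hb : b ∉ A) :
    (swap A v b).card = A.card := by
  have : 0 < A.card := Finset.card_pos.2 ⟨v, hv⟩
  rw [swap, Finset.card_insert_of_notMem (by simp [hb]), Finset.card_erase_of_mem hv]
  omega

theorem IsInducedMatching.swap [DecidableEq V] (hA : IsInducedMatching G A) {u v b : V}
    (hb : b ∉ A) (hbu : OnlyNbr G A b u) (huv : OnlyNbr G A u v) :
    IsInducedMatching G (swap A v b) := by
  have hvu := hA.symm hbu.mem huv
  have hne := huv.adj.ne
  intro a ha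
  rcases mem_swap.1 ha with rfl | ⟨hav, ha⟩
  · refine ⟨u, fun w => ?_⟩
    have := hbu w
    rw [mem_swap]
    grind [SimpleGraph.irrefl]
  · by_cases hau : a = u
    · subst hau
      refine ⟨b, fun w => ?_⟩
      have := huv w
      have := hbu.adj.symm
      rw [mem_swap]
      grind
    · obtain ⟨z, hz⟩ := hA a ha
      refine ⟨z, fun w => ?_⟩
      have h1 := hz w
      have h2 := hbu a
      have h3 := hvu a
      rw [mem_swap]
      grind [SimpleGraph.adj_comm]

/-- A vertex that becomes undominated when `v` is replaced with `b`. -/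
theorem onlyNbr_of_undominated_swap [DecidableEq V] {u v b q : V} (hA : IsInducedMatching G A)
    (hbu : OnlyNbr G A b u) (huv : OnlyNbr G A u v)
    (hq : ∀ a ∈ PerfectItalian.swap A v b, ¬ G.Adj q a) (hq' : ¬ ∀ a ∈ A, ¬ G.Adj q a) :
    OnlyNbr G A q v ∧ ¬ G.Adj q b ∧ q ∉ A := by
  have hne := huv.adj.ne
  have hu := hq u (mem_swap.2 (.inr ⟨hne, hbu.mem⟩))
  have hb := hq b (mem_swap.2 (.inl rfl))
  have h1 : ∀ a ∈ A, G.Adj q a → a = v := fun a ha h => by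
    by_contra hav
    exact hq a (mem_swap.2 (.inr ⟨hav, ha⟩)) h
  push Not at hq'
  obtain ⟨a, ha, haq⟩ := hq'
  obtain rfl := h1 a ha haq
  refine ⟨fun w => ⟨fun h => h1 w h.1 h.2, ?_⟩, hb, fun hqA => ?_⟩
  · rintro rfl; exact ⟨ha, haq⟩
  · have := (hA.symm hbu.mem huv).eq hqA haq.symm
    subst this
    exact hb hbu.adj.symm

theorem IsOptimal.adj_of_onlyNbr [Fintype V] (hA : IsOptimal G A) {c b u v q : V}
    (hc : ∀ a ∈ A, ¬ G.Adj c a) (hcb : G.Adj c b) (hbu : OnlyNbr G A b u)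
    (huv : OnlyNbr G A u v) (hq : OnlyNbr G A q v) (hqb : ¬ G.Adj q b) (hqA : q ∉ A) :
    G.Adj c q := by
  classical
  by_contra hcq
  have hvu := hA.isInducedMatching.symm hbu.mem huv
  have hbA : b ∉ A := fun h => hc b h hcb
  have hcA : c ∉ A := fun h => by
    obtain ⟨w, hw⟩ := hA.isInducedMatching c h
    exact hc w hw.mem hw.adj
  have hvA := huv.mem
  have huA := hvu.mem
  have hne := huv.adj.ne
  have hbq : b ≠ q := by
    rintro rfl
    exact hne (hq.eq huA hbu.adj)
  have hcq' : c ≠ q := by rintro rfl; exact hc v hvA hq.adj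
  have hbc := hcb.ne
  have : IsInducedMatching G (insert q (insert b (insert c (A.erase u)))) := by
    intro a ha
    simp only [Finset.mem_insert, Finset.mem_erase] at ha
    have hA' : ∀ w, w ∈ insert q (insert b (insert c (A.erase u))) ↔
        w = q ∨ w = b ∨ w = c ∨ w ≠ u ∧ w ∈ A := by simp
    rcases ha with rfl | rfl | rfl | ⟨hau, ha⟩
    · refine ⟨v, fun w => ?_⟩
      have := hq w
      rw [hA']
      grind [SimpleGraph.irrefl, SimpleGraph.adj_comm]
    · refine ⟨c, fun w => ?_⟩
      have := hbu w
      rw [hA']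
      grind [SimpleGraph.irrefl, SimpleGraph.adj_comm]
    · refine ⟨b, fun w => ?_⟩
      have := hc w
      rw [hA']
      grind [SimpleGraph.irrefl, SimpleGraph.adj_comm]
    · by_cases hav : a = v
      · subst hav
        refine ⟨q, fun w => ?_⟩
        have := hvu w
        have := hbu a
        have := hc a
        have := hq.adj.symm
        rw [hA']
        grind [SimpleGraph.adj_comm]
      · obtain ⟨z, hz⟩ := hA.isInducedMatching a ha
        refine ⟨z, fun w => ?_⟩
        have h1 := hz w
        have h2 := hbu a
        have h3 := hq a
        have h4 := huv a
        have h5 := hc a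
        rw [hA']
        grind [SimpleGraph.adj_comm]
  have hle := hA.card_le _ this
  have : 0 < A.card := Finset.card_pos.2 ⟨v, hvA⟩
  rw [Finset.card_insert_of_notMem (by grind), Finset.card_insert_of_notMem (by grind),
    Finset.card_insert_of_notMem (by grind), Finset.card_erase_of_mem huA] at hle
  omega

theorem IsOptimal.exists_onlyNbr [Fintype V] (hA : IsOptimal G A) {c b u v : V}
    (hc : ∀ a ∈ A, ¬ G.Adj c a) (hcb : G.Adj c b) (hbu : OnlyNbr G A b u)
    (huv : OnlyNbr G A u v) : ∃ q, G.Adj c q ∧ OnlyNbr G A q v ∧ ¬ G.Adj q b := by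
  classical
  have hbA : b ∉ A := fun h => hc b h hcb
  have hle := hA.undominated_le _ (hA.isInducedMatching.swap hbA hbu huv) (card_swap huv.mem hbA)
  have hcU : c ∈ undominated G A := mem_undominated.2 hc
  have hcU' : c ∉ undominated G (PerfectItalian.swap A v b) := fun h =>
    mem_undominated.1 h b (mem_swap.2 (.inl rfl)) hcb
  obtain ⟨q, hq, hq'⟩ : ∃ q ∈ undominated G (PerfectItalian.swap A v b), q ∉ undominated G A := by
    by_contra! hsub
    exact absurd (Finset.card_lt_card
      (Finset.ssubset_iff_subset_ne.2 ⟨hsub, fun h => hcU' (h ▸ hcU)⟩)) (not_lt.2 hle)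
  rw [mem_undominated] at hq hq'
  obtain ⟨h1, h2, h3⟩ := onlyNbr_of_undominated_swap hA.isInducedMatching hbu huv hq hq'
  exact ⟨q, hA.adj_of_onlyNbr hc hcb hbu huv h1 h2 h3, h1, h2⟩

end

section

section

variable {V : Type*} {G : SimpleGraph V} {A : Finset V}

/-- The vertex `x` has at least two neighbors in `A`. -/
def HasTwoNbrs (G : SimpleGraph V) (A : Finset V) (x : V) : Prop :=
  ∃ a ∈ A, ∃ b ∈ A, a ≠ b ∧ G.Adj x a ∧ G.Adj x b

theorem exists_onlyNbr_of_not_hasTwoNbrs {x : V} (h : ¬ HasTwoNbrs G A x)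
    (hx : ¬ ∀ a ∈ A, ¬ G.Adj x a) : ∃ u, OnlyNbr G A x u := by
  push Not at hx
  obtain ⟨u, hu, hxu⟩ := hx
  refine ⟨u, fun w => ⟨fun hw => ?_, ?_⟩⟩
  · by_contra hne
    exact h ⟨u, hu, w, hw.1, Ne.symm hne, hxu, hw.2⟩
  · rintro rfl
    exact ⟨hu, hxu⟩

/-- An undominated vertex `c` whose neighbors `p`, `q`, `r` have a single neighbor in `A`, which
is `u` for `p` and `q`, and its partner `v` for `r`. -/
structure IsBad (G : SimpleGraph V) (A : Finset V) (c p q r u v : V) : Prop where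
  ne : p ≠ q
  adj_iff : ∀ w, G.Adj c w ↔ w = p ∨ w = q ∨ w = r
  not_adj : ∀ w ∈ A, ¬ G.Adj c w
  left : OnlyNbr G A p u
  mid : OnlyNbr G A q u
  right : OnlyNbr G A r v
  partner : OnlyNbr G A u v

theorem IsBad.symm {c p q r u v : V} (h : IsBad G A c p q r u v) : IsBad G A c q p r u v :=
  ⟨h.ne.symm, fun w => by rw [h.adj_iff w]; tauto, h.not_adj, h.mid, h.left, h.right, h.partner⟩

theorem IsBad.notMem {c p q r u v : V} (h : IsBad G A c p q r u v) : p ∉ A ∧ q ∉ A ∧ r ∉ A :=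
  ⟨fun h' => h.not_adj _ h' ((h.adj_iff _).2 (.inl rfl)),
    fun h' => h.not_adj _ h' ((h.adj_iff _).2 (.inr (.inl rfl))),
    fun h' => h.not_adj _ h' ((h.adj_iff _).2 (.inr (.inr rfl)))⟩

end

variable {V : Type*} [Fintype V] {G : SimpleGraph V} {A : Finset V}

theorem IsCubic.exists_nbrs (hG : IsCubic G) (x : V) : ∃ p q r, p ≠ q ∧ p ≠ r ∧ q ≠ r ∧
    ∀ w, G.Adj x w ↔ w = p ∨ w = q ∨ w = r := by
  classical
  obtain ⟨p, q, r, h1, h2, h3, h⟩ := Finset.card_eq_three.1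
    ((G.card_neighborFinset_eq_degree x).trans (hG x))
  refine ⟨p, q, r, h1, h2, h3, fun w => ?_⟩
  rw [← SimpleGraph.mem_neighborFinset, h]
  simp

theorem IsCubic.exists_third (hG : IsCubic G) {x p q : V} (hp : G.Adj x p) (hq : G.Adj x q)
    (hpq : p ≠ q) : ∃ r, r ≠ p ∧ r ≠ q ∧ ∀ w, G.Adj x w ↔ w = p ∨ w = q ∨ w = r := by
  obtain ⟨a, b, c, h1, h2, h3, h⟩ := hG.exists_nbrs x
  rw [h] at hp hq
  rcases hp with rfl | rfl | rfl <;> rcases hq with rfl | rfl | rfl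
  · exact absurd rfl hpq
  · exact ⟨c, by grind⟩
  · exact ⟨b, by grind⟩
  · exact ⟨c, by grind⟩
  · exact absurd rfl hpq
  · exact ⟨a, by grind⟩
  · exact ⟨b, by grind⟩
  · exact ⟨a, by grind⟩
  · exact absurd rfl hpq

theorem IsOptimal.eq_or_eq_of_onlyNbr (hA : IsOptimal G A) {c p q r a b d : V}
    (hc : ∀ w, G.Adj c w ↔ w = p ∨ w = q ∨ w = r) (hcA : ∀ w ∈ A, ¬ G.Adj c w)
    (hp : OnlyNbr G A p a) (hq : OnlyNbr G A q b) (hab : OnlyNbr G A a b)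
    (hr : OnlyNbr G A r d) : d = a ∨ d = b := by
  obtain ⟨e, he⟩ := hA.isInducedMatching d hr.mem
  obtain ⟨z, hz, hze, -⟩ := hA.exists_onlyNbr hcA ((hc r).2 (.inr (.inr rfl))) hr he
  have hba := hA.isInducedMatching.symm hp.mem hab
  have hed := hA.isInducedMatching.symm hr.mem he
  rcases (hc z).1 hz with rfl | rfl | rfl
  · obtain rfl := hze.eq hp.mem hp.adj
    exact .inr (hab.eq hr.mem hed.adj)
  · obtain rfl := hze.eq hq.mem hq.adj
    exact .inl (hba.eq hr.mem hed.adj)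
  · exact absurd (hze.eq hr.mem hr.adj) he.adj.ne

theorem IsOptimal.exists_isBad (hG : IsCubic G) (hA : IsOptimal G A) {c : V}
    (hc : ∀ w ∈ A, ¬ G.Adj c w) (h : ∀ b, G.Adj c b → ¬ HasTwoNbrs G A b) :
    ∃ p q r u v, IsBad G A c p q r u v := by
  have honly : ∀ b, G.Adj c b → ∃ u, OnlyNbr G A b u := fun b hb =>
    exists_onlyNbr_of_not_hasTwoNbrs (h b hb) fun h' => hA.not_adj_of_undominated hc h' hb
  obtain ⟨p, _, _, -, -, -, hp⟩ := hG.exists_nbrs c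
  replace hp := (hp p).2 (.inl rfl)
  obtain ⟨u, hu⟩ := honly p hp
  obtain ⟨v, huv⟩ := hA.isInducedMatching u hu.mem
  obtain ⟨q, hq, hqv, -⟩ := hA.exists_onlyNbr hc hp hu huv
  have hpq : p ≠ q := by
    rintro rfl
    exact huv.adj.ne (hqv.eq hu.mem hu.adj)
  obtain ⟨r, hrp, hrq, hN⟩ := hG.exists_third hp hq hpq
  obtain ⟨d, hd⟩ := honly r ((hN r).2 (.inr (.inr rfl)))
  rcases hA.eq_or_eq_of_onlyNbr hN hc hu hqv huv hd with rfl | rfl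
  · exact ⟨p, r, q, d, v, hrp.symm, fun w => by rw [hN w]; tauto, hc, hu, hd, hqv, huv⟩
  · exact ⟨q, r, p, d, u, hrq.symm, fun w => by rw [hN w]; tauto, hc, hqv, hd, hu,
      hA.isInducedMatching.symm hu.mem huv⟩

theorem IsBad.not_adj_left {c p q r u v : V} (h : IsBad G A c p q r u v) (hA : IsOptimal G A) :
    ¬ G.Adj r p := by
  obtain ⟨z, hz, hzv, hzp⟩ := hA.exists_onlyNbr h.not_adj ((h.adj_iff p).2 (.inl rfl)) h.left
    h.partner
  have hne := h.partner.adj.ne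
  rcases (h.adj_iff z).1 hz with rfl | rfl | rfl
  · exact absurd (hzv.eq h.left.mem h.left.adj) hne
  · exact absurd (hzv.eq h.mid.mem h.mid.adj) hne
  · exact hzp

theorem IsBad.undominated_swap [DecidableEq V] {c p q r u v : V} (h : IsBad G A c p q r u v)
    (hA : IsOptimal G A) {x : V} (hx : x ∈ undominated G (PerfectItalian.swap A v p)) :
    x = r ∨ x ∈ undominated G A ∧ ¬ G.Adj x p := by
  rw [mem_undominated] at hx
  by_cases hxU : x ∈ undominated G A
  · exact .inr ⟨hxU, hx p (mem_swap.2 (.inl rfl))⟩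
  · rw [mem_undominated] at hxU
    obtain ⟨h1, h2, h3⟩ := onlyNbr_of_undominated_swap hA.isInducedMatching h.left h.partner hx hxU
    have hcx := hA.adj_of_onlyNbr h.not_adj ((h.adj_iff p).2 (.inl rfl)) h.left h.partner h1 h2 h3
    have hne := h.partner.adj.ne
    rcases (h.adj_iff x).1 hcx with rfl | rfl | rfl
    · exact absurd (h1.eq h.left.mem h.left.adj) hne
    · exact absurd (h1.eq h.mid.mem h.mid.adj) hne
    · exact .inl rfl

theorem IsBad.isOptimal_swap [DecidableEq V] {c p q r u v : V} (h : IsBad G A c p q r u v)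
    (hA : IsOptimal G A) : IsOptimal G (PerfectItalian.swap A v p) := by
  have hpA := h.notMem.1
  have hcard := card_swap h.partner.mem hpA
  have hcU : c ∈ undominated G A := mem_undominated.2 h.not_adj
  refine ⟨hA.isInducedMatching.swap hpA h.left h.partner, fun B hB => hcard ▸ hA.card_le B hB,
    fun B hB hBc => le_trans ?_ (hA.undominated_le B hB (hBc.trans hcard))⟩
  have hsub : undominated G (PerfectItalian.swap A v p) ⊆
      insert r ((undominated G A).erase c) := fun x hx => by
    rw [Finset.mem_insert, Finset.mem_erase]
    refine (h.undominated_swap hA hx).imp_right fun h' => ⟨?_, h'.1⟩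
    rintro rfl
    exact h'.2 ((h.adj_iff p).2 (.inl rfl))
  refine (Finset.card_le_card hsub).trans ((Finset.card_insert_le _ _).trans ?_)
  rw [Finset.card_erase_add_one hcU]

theorem IsBad.eq_of_undominated {c p q r u v y : V} (h : IsBad G A c p q r u v)
    (hA : IsOptimal G A) (hy : ∀ a ∈ A, ¬ G.Adj y a) (hyp : G.Adj y p) : y = c := by
  classical
  by_contra hyc
  have hpA := h.notMem.1
  have hle := hA.undominated_le _ (hA.isInducedMatching.swap hpA h.left h.partner)
    (card_swap h.partner.mem hpA)
  have hcU : c ∈ undominated G A := mem_undominated.2 h.not_adj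
  have hyU : y ∈ (undominated G A).erase c := Finset.mem_erase.2 ⟨hyc, mem_undominated.2 hy⟩
  have hsub : undominated G (PerfectItalian.swap A v p) ⊆
      insert r (((undominated G A).erase c).erase y) := fun x hx => by
    simp only [Finset.mem_insert, Finset.mem_erase]
    refine (h.undominated_swap hA hx).imp_right fun h' => ⟨?_, ?_, h'.1⟩
    · rintro rfl
      exact h'.2 hyp
    · rintro rfl
      exact h'.2 ((h.adj_iff p).2 (.inl rfl))
  have h1 := (Finset.card_le_card hsub).trans (Finset.card_insert_le _ _)
  rw [Finset.card_erase_add_one hyU] at h1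
  have := Finset.card_erase_add_one hcU
  omega

theorem IsBad.adj_left (hG : IsCubic G) (hA : IsOptimal G A) {c p q r u v y : V}
    (h : IsBad G A c p q r u v) (hr : ∀ w, G.Adj r w ↔ w = v ∨ w = c ∨ w = y) (hyv : y ≠ v)
    (hy : ¬ HasTwoNbrs G A y) : G.Adj y p := by
  classical
  by_contra hyp
  have hA' := h.isOptimal_swap hA
  have hvu := hA.isInducedMatching.symm h.left.mem h.partner
  have hne := h.partner.adj.ne
  have hrp := h.not_adj_left hA
  have hrq := h.symm.not_adj_left hA
  have hcp : G.Adj c p := (h.adj_iff p).2 (.inl rfl)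
  have hry : G.Adj r y := (hr y).2 (.inr (.inr rfl))
  have hyA : y ∉ A := fun h' => hyv (h.right.eq h' hry)
  have hpA := h.notMem.1
  have hup : u ∈ swap A v p := mem_swap.2 (.inr ⟨hne, h.left.mem⟩)
  have hpp : p ∈ swap A v p := mem_swap.2 (.inl rfl)
  have hrU : ∀ a ∈ swap A v p, ¬ G.Adj r a := fun a ha hra => by
    rcases mem_swap.1 ha with rfl | ⟨hav, ha⟩
    · exact hrp hra
    · exact hav (h.right.eq ha hra)
  have hv : OnlyNbr G (swap A v p) v u := fun w => by
    have h1 := hvu w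
    have h2 := h.left v
    have h3 := h.partner.mem
    rw [mem_swap]
    grind [SimpleGraph.adj_comm]
  have hc : OnlyNbr G (swap A v p) c p := fun w => by
    have h1 := h.not_adj w
    rw [mem_swap]
    grind
  have hy' : ¬ HasTwoNbrs G (swap A v p) y := by
    rintro ⟨a, ha, b, hb, hab, hya, hyb⟩
    rw [mem_swap] at ha hb
    exact hy ⟨a, by grind, b, by grind, hab, hya, hyb⟩
  obtain ⟨d, hd⟩ := exists_onlyNbr_of_not_hasTwoNbrs hy'
    fun h' => hA'.not_adj_of_undominated hrU h' hry
  rcases hA'.eq_or_eq_of_onlyNbr hr hrU hv hc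
    (hA'.isInducedMatching.onlyNbr hup hpp h.left.adj.symm) hd with rfl | rfl
  · obtain ⟨z, hzp, hzq, hz⟩ := hG.exists_third h.left.adj.symm h.mid.adj.symm h.ne
    have h1 := hz v
    have h2 := hz y
    have h3 := hd.adj.symm
    have h4 := h.partner.adj
    have h5 := h.partner.mem
    have := h.notMem
    grind
  · exact hyp hd.adj

theorem IsBad.exists_hasTwoNbrs (hG : IsCubic G) (hA : IsOptimal G A) {c p q r u v : V}
    (h : IsBad G A c p q r u v) :
    ∃ y, HasTwoNbrs G A y ∧ ∀ w, G.Adj r w ↔ w = v ∨ w = c ∨ w = y := by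
  have hvc : v ≠ c := by
    rintro rfl
    exact h.not_adj u h.left.mem h.partner.adj.symm
  have hrc : G.Adj r c := ((h.adj_iff r).2 (.inr (.inr rfl))).symm
  obtain ⟨y, hyv, hyc, hr⟩ := hG.exists_third h.right.adj hrc hvc
  refine ⟨y, ?_, hr⟩
  by_contra hy
  have hyp := h.adj_left hG hA hr hyv hy
  have hyq := h.symm.adj_left hG hA hr hyv hy
  have hyr : G.Adj y r := ((hr y).2 (.inr (.inr rfl))).symm
  have hne := h.partner.adj.ne
  have hpr : p ≠ r := by
    rintro rfl
    exact hne (h.right.eq h.left.mem h.left.adj)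
  have hqr : q ≠ r := by
    rintro rfl
    exact hne (h.right.eq h.mid.mem h.mid.adj)
  obtain ⟨z, hzp, hzq, hz⟩ := hG.exists_third hyp hyq h.ne
  obtain ⟨h1, h2, h3⟩ := h.notMem
  have h4 := (hz r).1 hyr
  refine hyc (h.eq_of_undominated hA (fun a ha hya => ?_) hyp)
  have := (hz a).1 hya
  grind

theorem IsOptimal.card_undominated_le (hG : IsCubic G) (hA : IsOptimal G A) [DecidableEq V]
    [DecidablePred (HasTwoNbrs G A)] :
    (undominated G A).card ≤ (Finset.univ.filter (HasTwoNbrs G A)).card := by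
  refine Finset.card_le_card_of_forall_subsingleton
    (fun c y => ∃ z, G.Adj y z ∧ z ∉ A ∧ (z = c ∨ G.Adj z c) ∧
      ∀ c' ∈ undominated G A, z = c' ∨ G.Adj z c' → c' = c) (fun c hc => ?_) fun y hy => ?_
  · have hcA := mem_undominated.1 hc
    have hnot : ∀ {x}, (∀ w ∈ A, ¬ G.Adj x w) → x ∉ A := fun hx h => by
      obtain ⟨w, hw⟩ := hA.isInducedMatching _ h
      exact hx w hw.mem hw.adj
    by_cases h : ∃ b, G.Adj c b ∧ HasTwoNbrs G A b
    · obtain ⟨b, hcb, hb⟩ := h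
      refine ⟨b, by simpa using hb, c, hcb.symm, hnot hcA, .inl rfl, fun c' hc' h' => ?_⟩
      exact h'.elim Eq.symm fun h' =>
        absurd h' (hA.not_adj_of_undominated hcA (mem_undominated.1 hc'))
    · push Not at h
      obtain ⟨p, q, r, u, v, hbad⟩ := hA.exists_isBad hG hcA h
      obtain ⟨y, hy, hr⟩ := hbad.exists_hasTwoNbrs hG hA
      refine ⟨y, by simpa using hy, r, ((hr y).2 (.inr (.inr rfl))).symm, hbad.notMem.2.2,
        .inr ((hr c).2 (.inr (.inl rfl))), fun c' hc' h' => ?_⟩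
      rw [mem_undominated] at hc'
      rcases h' with rfl | h'
      · exact absurd hbad.right.adj (hc' v hbad.right.mem)
      · rcases (hr c').1 h' with rfl | rfl | rfl
        · exact absurd hbad.partner.adj.symm (hc' u hbad.left.mem)
        · rfl
        · obtain ⟨a, ha, -, -, -, hya, -⟩ := hy
          exact absurd hya (hc' a ha)
  · obtain ⟨a, ha, b, hb, hab, hya, hyb⟩ := (Finset.mem_filter.1 hy).2
    rintro c ⟨-, z, hz, hzA, -, hzc⟩ c' ⟨hc', z', hz', hzA', hzc', -⟩
    obtain ⟨t, -, -, ht⟩ := hG.exists_third hya hyb hab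
    have h1 := (ht z).1 hz
    have h2 := (ht z').1 hz'
    have : z = z' := by grind
    subst this
    exact (hzc c' hc' hzc').symm

end

section

variable {V : Type*} [Fintype V] {G : SimpleGraph V} {A : Finset V}

open Classical in
theorem IsCubic.sum_card_inter (hG : IsCubic G) (A : Finset V) :
    ∑ x, (A.filter (G.Adj x)).card = 3 * A.card := by
  change ∑ x, (A.bipartiteAbove G.Adj x).card = _
  rw [Finset.sum_card_bipartiteAbove_eq_sum_card_bipartiteBelow]
  trans ∑ a ∈ A, 3
  · refine Finset.sum_congr rfl fun a _ => ?_
    rw [← hG a, ← G.card_neighborFinset_eq_degree]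
    congr 1
    ext x
    simp [Finset.bipartiteBelow, SimpleGraph.adj_comm]
  · simp [mul_comm]

theorem IsOptimal.card_le_three_mul (hG : IsCubic G) (hA : IsOptimal G A) :
    Fintype.card V ≤ 3 * A.card := by
  classical
  have hle := hA.card_undominated_le hG
  rw [Finset.card_filter] at hle
  have hpt : ∀ x, 1 + (if HasTwoNbrs G A x then 1 else 0) ≤
      (A.filter (G.Adj x)).card + (if x ∈ undominated G A then 1 else 0) := fun x => by
    by_cases hx : x ∈ undominated G A
    · have h2 : ¬ HasTwoNbrs G A x := by
        rintro ⟨a, ha, -, -, -, hxa, -⟩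
        exact mem_undominated.1 hx a ha hxa
      simp [hx, h2]
    · have h1 : ∃ a ∈ A, G.Adj x a := by simpa [mem_undominated] using hx
      obtain ⟨a, ha, hxa⟩ := h1
      have ha' : a ∈ A.filter (G.Adj x) := by simp [ha, hxa]
      by_cases h2 : HasTwoNbrs G A x
      · obtain ⟨b, hb, c, hc, hbc, hxb, hxc⟩ := h2
        have : 1 < (A.filter (G.Adj x)).card :=
          Finset.one_lt_card.2 ⟨b, by simp [hb, hxb], c, by simp [hc, hxc], hbc⟩
        split_ifs <;> omega
      · have := Finset.card_pos.2 ⟨a, ha'⟩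
        simp only [h2, hx, if_false]
        omega
  have hsum := Finset.sum_le_sum fun x (_ : x ∈ Finset.univ) => hpt x
  rw [Finset.sum_add_distrib, Finset.sum_add_distrib, hG.sum_card_inter,
    ← Finset.card_filter (· ∈ undominated G A), Finset.filter_mem_eq_inter, Finset.univ_inter] at hsum
  simp only [Finset.sum_const, Finset.card_univ, smul_eq_mul, mul_one] at hsum
  omega

theorem pid_le (f : V → Fin 3) (hf : IsPID G f) : pid G ≤ weight f :=
  (isLeast_pid G).2 ⟨f, hf, rfl⟩

theorem IsInducedMatching.pid_add_card_le (hG : IsCubic G) (hA : IsInducedMatching G A) :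
    pid G + A.card ≤ Fintype.card V := by
  classical
  have hf : IsPID G fun x => if x ∈ A then 0 else 1 := fun a ha => by
    have haA : a ∈ A := by
      by_contra h
      simp [h] at ha
    obtain ⟨v, hv⟩ := hA a haA
    have h1 : ∀ u, (((if u ∈ A then 0 else 1 : Fin 3) : Fin 3) : ℕ) = if u ∉ A then 1 else 0 :=
      fun u => by split_ifs <;> simp_all
    simp only [h1]
    rw [← Finset.card_filter]
    have h2 : (G.neighborFinset a).filter (· ∉ A) = (G.neighborFinset a).erase v := by
      ext w
      have := hv w
      simp only [Finset.mem_filter, SimpleGraph.mem_neighborFinset, Finset.mem_erase]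
      grind
    rw [h2, Finset.card_erase_of_mem (by simpa using hv.adj), G.card_neighborFinset_eq_degree]
    have := hG a
    grind
  refine (Nat.add_le_add_right (pid_le _ hf) _).trans_eq ?_
  rw [weight, ← Finset.card_compl_add_card A, Finset.card_eq_sum_ones (Aᶜ)]
  congr 1
  rw [← Finset.sum_add_sum_compl A, Finset.sum_eq_zero fun x hx => by simp [hx], zero_add]
  exact Finset.sum_congr rfl fun x hx => by simp_all

theorem IsCubic.three_mul_pid_le (hG : IsCubic G) : 3 * pid G ≤ 2 * Fintype.card V := by
  obtain ⟨A, hA⟩ := exists_isOptimal G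
  have h1 := hA.card_le_three_mul hG
  have h2 := hA.isInducedMatching.pid_add_card_le hG
  omega

theorem IsPID.two_mul_card_le (hG : IsCubic G) {f : V → Fin 3} (hf : IsPID G f) :
    2 * Fintype.card V ≤ 5 * weight f := by
  classical
  have hsum : ∑ v, ∑ u ∈ G.neighborFinset v, (f u : ℕ) = 3 * weight f := by
    rw [weight, Finset.mul_sum]
    rw [Finset.sum_comm' (t' := Finset.univ) (s' := fun u => G.neighborFinset u)
      (by simp [SimpleGraph.adj_comm])]
    refine Finset.sum_congr rfl fun u _ => ?_
    rw [Finset.sum_const, G.card_neighborFinset_eq_degree, smul_eq_mul]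
    congr 1
    convert hG u
  have hpt : ∀ v, 2 ≤ ∑ u ∈ G.neighborFinset v, (f u : ℕ) + 2 * (f v : ℕ) := fun v => by
    by_cases h : f v = 0
    · have := hf v h
      have h' : ∑ u ∈ G.neighborFinset v, (f u : ℕ) = 2 := by convert this
      omega
    · have : (f v : ℕ) ≠ 0 := fun h' => h (Fin.ext h')
      omega
  have h := Finset.sum_le_sum fun v (_ : v ∈ Finset.univ) => hpt v
  rw [Finset.sum_add_distrib, hsum, ← Finset.mul_sum] at h
  simp only [Finset.sum_const, Finset.card_univ, smul_eq_mul] at h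
  rw [weight] at h ⊢
  omega

theorem IsCubic.two_mul_card_le (hG : IsCubic G) : 2 * Fintype.card V ≤ 5 * pid G := by
  obtain ⟨f, hf, hw⟩ := (isLeast_pid G).1
  exact hw ▸ hf.two_mul_card_le hG

end

section

theorem isCubic_of_decidable {V : Type*} [Fintype V] {G : SimpleGraph V} [DecidableRel G.Adj]
    (h : ∀ v, (Finset.univ.filter (G.Adj v)).card = 3) : IsCubic G := fun v => by
  classical
  rw [← h v, ← G.card_neighborFinset_eq_degree]
  congr 1
  ext
  simp

theorem isPID_iff {V : Type*} [Fintype V] {G : SimpleGraph V} [DecidableRel G.Adj]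
    {f : V → Fin 3} :
    IsPID G f ↔ ∀ v, f v = 0 → ∑ u, (if G.Adj v u then (f u : ℕ) else 0) = 2 := by
  classical
  refine forall₂_congr fun v _ => ?_
  rw [← Finset.sum_filter]
  congr! 2
  ext
  simp

/-- The Petersen graph, with outer cycle `0, …, 4` and inner pentagram `5, …, 9`. -/
def petersen : SimpleGraph (Fin 10) :=
  SimpleGraph.fromRel fun i j =>
    (i.val < 5 ∧ (j.val = (i.val + 1) % 5 ∨ j.val = i.val + 5)) ∨
      (5 ≤ i.val ∧ j.val = (i.val + 2) % 5 + 5)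

instance : DecidableRel petersen.Adj := fun i j =>
  inferInstanceAs (Decidable (i ≠ j ∧ _))

theorem petersen_isCubic : IsCubic petersen := isCubic_of_decidable (by decide)

theorem petersen_connected : petersen.Connected := by
  have h : ∀ i, petersen.Adj 0 i ∨ i = 0 ∨ ∃ j, petersen.Adj 0 j ∧ petersen.Adj j i := by decide
  have h' : ∀ i, petersen.Reachable 0 i := fun i => by
    rcases h i with h | rfl | ⟨j, h1, h2⟩
    · exact h.reachable
    · exact .refl _
    · exact h1.reachable.trans h2.reachable
  exact ⟨fun i j => (h' i).symm.trans (h' j)⟩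

theorem pid_petersen : pid petersen = 4 := by
  have h1 := petersen_isCubic.two_mul_card_le
  have h2 := pid_le (G := petersen) ![1, 0, 1, 0, 0, 0, 0, 0, 1, 1] (isPID_iff.2 (by decide))
  have h3 : weight (![1, 0, 1, 0, 0, 0, 0, 0, 1, 1] : Fin 10 → Fin 3) = 4 := by decide
  simp only [Fintype.card_fin] at h1
  omega

instance : DecidableRel (SimpleGraph.pathGraph 2).Adj := fun i j =>
  decidable_of_iff (i ≠ j) (by rw [SimpleGraph.pathGraph_adj]; omega)

instance {α β : Type*} [DecidableEq α] [DecidableEq β] {G : SimpleGraph α} {H : SimpleGraph β}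
    [DecidableRel G.Adj] [DecidableRel H.Adj] : DecidableRel (G.boxProd H).Adj :=
  fun _ _ => decidable_of_iff _ SimpleGraph.boxProd_adj.symm

instance : DecidableRel Q3.Adj := inferInstanceAs (DecidableRel (SimpleGraph.boxProd _ _).Adj)

instance : DecidableRel K3boxK2.Adj :=
  inferInstanceAs (DecidableRel (SimpleGraph.boxProd _ _).Adj)

instance : DecidableRel K33.Adj := fun x y =>
  inferInstanceAs (Decidable (x.isLeft ∧ y.isRight ∨ x.isRight ∧ y.isLeft))

theorem Q3_isCubic : IsCubic Q3 := isCubic_of_decidable (by decide)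

theorem Q3_connected : Q3.Connected :=
  ((SimpleGraph.pathGraph_connected 1).boxProd (SimpleGraph.pathGraph_connected 1)).boxProd
    (SimpleGraph.pathGraph_connected 1)

theorem pid_Q3 : pid Q3 = 4 := by
  have h1 := Q3_isCubic.two_mul_card_le
  have h2 := pid_le (G := Q3)
    (fun x => if x = ((0, 0), 0) ∨ x = ((1, 1), 1) then 2 else 0) (isPID_iff.2 (by decide))
  have h3 : weight (fun x : (Fin 2 × Fin 2) × Fin 2 =>
    if x = ((0, 0), 0) ∨ x = ((1, 1), 1) then (2 : Fin 3) else 0) = 4 := by decide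
  simp only [Fintype.card_prod, Fintype.card_fin] at h1
  omega

theorem K3boxK2_isCubic : IsCubic K3boxK2 := isCubic_of_decidable (by decide)

theorem K3boxK2_connected : K3boxK2.Connected :=
  SimpleGraph.connected_top.boxProd SimpleGraph.connected_top

theorem pid_K3boxK2 : pid K3boxK2 = 4 := by
  have h1 := K3boxK2_isCubic.three_mul_pid_le
  simp only [Fintype.card_prod, Fintype.card_fin] at h1
  refine le_antisymm (by omega) ?_
  obtain ⟨f, hf, hw⟩ := (isLeast_pid K3boxK2).1
  rw [← hw]
  rw [isPID_iff] at hf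
  have h00 := hf (0, 0)
  have h01 := hf (0, 1)
  have h10 := hf (1, 0)
  have h11 := hf (1, 1)
  have h20 := hf (2, 0)
  have h21 := hf (2, 1)
  simp [K3boxK2, Fintype.sum_prod_type, Fin.sum_univ_succ] at h00 h01 h10 h11 h20 h21
  simp only [weight, Fintype.sum_prod_type, Fin.sum_univ_three, Fin.sum_univ_two]
  simp only [Fin.ext_iff] at h00 h01 h10 h11 h20 h21
  omega

theorem K33_isCubic : IsCubic K33 := isCubic_of_decidable (by decide)

theorem K33_connected : K33.Connected := by
  have h : ∀ i, K33.Adj (.inl 0) i ∨ ∃ j, K33.Adj (.inl 0) j ∧ K33.Adj j i := by decide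
  have h' : ∀ i, K33.Reachable (.inl 0) i := fun i => by
    rcases h i with h | ⟨j, h1, h2⟩
    · exact h.reachable
    · exact h1.reachable.trans h2.reachable
  exact ⟨fun i j => (h' i).symm.trans (h' j)⟩

theorem pid_K33 : pid K33 = 4 := by
  have h1 := K33_isCubic.three_mul_pid_le
  simp only [Fintype.card_sum, Fintype.card_fin] at h1
  refine le_antisymm (by omega) ?_
  obtain ⟨f, hf, hw⟩ := (isLeast_pid K33).1
  rw [← hw]
  rw [isPID_iff] at hf
  have h0 := hf (.inl 0)
  have h1 := hf (.inl 1)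
  have h2 := hf (.inl 2)
  have h3 := hf (.inr 0)
  have h4 := hf (.inr 1)
  have h5 := hf (.inr 2)
  simp [K33, Fin.sum_univ_three] at h0 h1 h2 h3 h4 h5
  simp only [weight, Fintype.sum_sum_type, Fin.sum_univ_three]
  simp only [Fin.ext_iff] at h0 h1 h2 h3 h4 h5
  omega

end

end PerfectItalian

theorem mainTheorem2 :
    -- the bounds, for every connected cubic graph on `n = |V|` vertices
    (∀ (V : Type*) [Fintype V] (G : SimpleGraph V), G.Connected → PerfectItalian.IsCubic G →
      (2 / 5 : ℚ) * Fintype.card V ≤ PerfectItalian.pid G ∧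
      (PerfectItalian.pid G : ℚ) ≤ (2 / 3 : ℚ) * Fintype.card V) ∧
    -- tightness of the lower bound: equality occurs
    (∃ (n : ℕ) (G : SimpleGraph (Fin n)), G.Connected ∧ PerfectItalian.IsCubic G ∧
      (PerfectItalian.pid G : ℚ) = (2 / 5 : ℚ) * n) ∧
    -- tightness of the lower bound, up to rounding, at the cube (8 vertices)
    (PerfectItalian.Q3.Connected ∧ PerfectItalian.IsCubic PerfectItalian.Q3 ∧
      PerfectItalian.pid PerfectItalian.Q3 = 4 ∧
      (PerfectItalian.pid PerfectItalian.Q3 : ℤ) =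
        ⌈(2 / 5 : ℚ) * Fintype.card ((Fin 2 × Fin 2) × Fin 2)⌉) ∧
    -- tightness of the upper bound at the prism (6 vertices)
    (PerfectItalian.K3boxK2.Connected ∧ PerfectItalian.IsCubic PerfectItalian.K3boxK2 ∧
      PerfectItalian.pid PerfectItalian.K3boxK2 = 4 ∧
      (PerfectItalian.pid PerfectItalian.K3boxK2 : ℚ) =
        (2 / 3 : ℚ) * Fintype.card (Fin 3 × Fin 2)) ∧
    -- tightness of the upper bound at `K₃,₃` (6 vertices)
    (PerfectItalian.K33.Connected ∧ PerfectItalian.IsCubic PerfectItalian.K33 ∧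
      PerfectItalian.pid PerfectItalian.K33 = 4 ∧
      (PerfectItalian.pid PerfectItalian.K33 : ℚ) =
        (2 / 3 : ℚ) * Fintype.card (Fin 3 ⊕ Fin 3)) := by
  open PerfectItalian in
  refine ⟨fun V _ G _ hG => ⟨?_, ?_⟩,
    ⟨10, petersen, petersen_connected, petersen_isCubic, by rw [pid_petersen]; norm_num⟩,
    ⟨Q3_connected, Q3_isCubic, pid_Q3, ?_⟩,
    ⟨K3boxK2_connected, K3boxK2_isCubic, pid_K3boxK2, by rw [pid_K3boxK2]; norm_num⟩,
    ⟨K33_connected, K33_isCubic, pid_K33, by rw [pid_K33]; norm_num⟩⟩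
  · have h : (2 * Fintype.card V : ℚ) ≤ 5 * pid G := mod_cast hG.two_mul_card_le
    linarith
  · have h : (3 * pid G : ℚ) ≤ 2 * Fintype.card V := mod_cast hG.three_mul_pid_le
    linarith
  · rw [pid_Q3, eq_comm, Int.ceil_eq_iff]
    norm_num
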